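/- Let $p$ be a prime, $N\in\mathbb Z$, $\alpha>0$, let $B_N=\{x\in\mathbb Q_p:|x|_p\le p^N\}$, and let $dx$ be the Haar measure of $\mathbb Q_p$ with $\int_{\mathbb Z_p}dx=1$. All function spaces below consist of real-valued functions. On the space $\mathcal D(B_N)$ of locally constant functions on $B_N$ let $D_N^\alpha$ be the Vladimirov operator $$(D_N^\alpha u)(x)=\lambda_0u(x)+\frac{1-p^\alpha}{1-p^{-\alpha-1}}\int_{B_N}|y|_p^{-\alpha-1}\,[u(x-y)-u(x)]\,dy,\qquad \lambda_0=\frac{p-1}{p^{\alpha+1}-1}\,p^{\alpha(1-N)}.$$ Let $H_1\subset L_2(B_N)$ be the Hilbert space obtained by completing $\mathcal D(B_N)$ for the inner product $(u,v)_{H_1}=\int_{B_N}(D_N^\alpha u)\,v\,dx$ (so $\|u\|_{H_1}^2=\sum_k\mathfrak a_k|c_k|^2$ if $u=\sum_kc_k\psi_k$ in an orthonormal basis of eigenfunctions of $D_N^\alpha$ with eigenvalues $\mathfrak a_k$), and let $H_{-1}$ be its dual. The operator $D_N^\alpha$ extends to an isometric isomorphism $H_1\to H_{-1}$, and $H_{-1}$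 carries the inner product $(f,g)_{H_{-1}}=\big([D_N^\alpha]^{-1}f,[D_N^\alpha]^{-1}g\big)_{H_1}$. An element $u\in H_{-1}$ belongs to $L_1(B_N)$ if there is $\tilde u\in L_1(B_N)$ with $\langle u,\psi\rangle=\int_{B_N}\tilde u\,\psi\,dx$ for all $\psi\in\mathcal D(B_N)$; then $\tilde u$ is unique and one writes $u(x)$ for $\tilde u(x)$. Let $j:\mathbb R\to[0,\infty]$ be convex and lower semicontinuous with $j(0)=0$ and $j(r)/|r|\to\infty$ as $|r|\to\infty$, and let $\varphi=\partial j$, that is, $\varphi(r)=\{\rho\in\mathbb R: j(s)-j(r)\ge\rho\,(s-r)\ \text{for all } s \text{ with } j(s)<\infty\}$. For $u\in H_{-1}$ put $\Psi(u)=\int_{B_N}j(u(x))\,dx$ if $u\in L_1(B_N)$ and $j(u)\in L_1(B_N)$, and $\Psi(u)=+\infty$ otherwise, and let $$\partial\Psi(u)=\{g\in H_{-1}:\ \Psi(v)-\Psi(u)\ge(g,v-u)_{H_{-1}}\ \text{for all } v\in H_{-1}\text{ with }\Psi(v)<\infty\}.$$ Then for all $u,f\in H_{-1}$, $$f\in\partial\Psi(u)\iff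 u\in L_1(B_N)\ \text{ and }\ \big([D_N^\alpha]^{-1}f\big)(x)\in\varphi(u(x))\ \text{ for a.e. }x\in B_N.$$ -/

import Mathlib

open MeasureTheory Filter Topology
open scoped NNReal ENNReal InnerProductSpace

namespace PadicPorous

noncomputable section

/-! ### The field of `p`-adic numbers with its Haar measure, and the ball `B_N` -/

instance instMeasurableSpacePadic (p : ℕ) [Fact p.Prime] : MeasurableSpace ℚ_[p] := borel _

instance instBorelSpacePadic (p : ℕ) [Fact p.Prime] : BorelSpace ℚ_[p] := ⟨rfl⟩

/-- The compact unit ball of `ℚ_p`, used to normalise the Haar measure. -/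
def unitBall (p : ℕ) [Fact p.Prime] : TopologicalSpace.PositiveCompacts ℚ_[p] where
  carrier := Metric.closedBall 0 1
  isCompact' := isCompact_closedBall 0 1
  interior_nonempty' := ⟨0, Metric.ball_subset_interior_closedBall (Metric.mem_ball_self one_pos)⟩

/-- `dx`: the additive Haar measure of `ℚ_p` which gives the unit ball `ℤ_p` mass `1`. -/
instance instMeasureSpacePadic (p : ℕ) [Fact p.Prime] : MeasureSpace ℚ_[p] where
  volume := Measure.addHaarMeasure (unitBall p)

instance instIsAddHaarMeasurePadic (p : ℕ) [Fact p.Prime] :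
    (volume : Measure ℚ_[p]).IsAddHaarMeasure :=
  inferInstanceAs (Measure.addHaarMeasure (unitBall p)).IsAddHaarMeasure

/-- The ball `B_N = {x ∈ ℚ_p : |x|_p ≤ p ^ N}`, an additive subgroup of `ℚ_p`. -/
def ballSubgroup (p : ℕ) [Fact p.Prime] (N : ℤ) : AddSubgroup ℚ_[p] where
  carrier := {x | ‖x‖ ≤ (p : ℝ) ^ N}
  zero_mem' := by
    have : (0 : ℝ) ≤ (p : ℝ) ^ N := by positivity
    simpa using this
  add_mem' := fun {a b} ha hb =>
    (IsUltrametricDist.norm_add_le_max a b).trans (max_le ha hb)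
  neg_mem' := fun {a} ha => by simpa using ha

/-- The ball `B_N` as a type.  It carries the subspace topology, the group structure, and
(as `volume`) the restriction of the Haar measure `dx` of `ℚ_p`. -/
abbrev Ball (p : ℕ) [Fact p.Prime] (N : ℤ) : Type := ↥(ballSubgroup p N)

instance instMeasureSpaceBall (p : ℕ) [Fact p.Prime] (N : ℤ) : MeasureSpace (Ball p N) where
  volume := Measure.comap Subtype.val (volume : Measure ℚ_[p])

theorem coe_ballSubgroup (p : ℕ) [Fact p.Prime] (N : ℤ) :
    (ballSubgroup p N : Set ℚ_[p]) = Metric.closedBall 0 ((p : ℝ) ^ N) := by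
  ext x
  simp [ballSubgroup]

instance instCompactSpaceBall (p : ℕ) [Fact p.Prime] (N : ℤ) : CompactSpace (Ball p N) :=
  isCompact_iff_compactSpace.mp
    (show IsCompact (ballSubgroup p N : Set ℚ_[p]) by
      rw [coe_ballSubgroup]; exact isCompact_closedBall _ _)

theorem isOpen_ballSubgroup (p : ℕ) [hp : Fact p.Prime] (N : ℤ) :
    IsOpen (ballSubgroup p N : Set ℚ_[p]) := by
  rw [coe_ballSubgroup]
  have : (0 : ℝ) < (p : ℝ) ^ N := zpow_pos (by exact_mod_cast hp.out.pos) N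
  exact IsUltrametricDist.isOpen_closedBall 0 this.ne'

instance instIsAddHaarMeasureBall (p : ℕ) [Fact p.Prime] (N : ℤ) :
    (volume : Measure (Ball p N)).IsAddHaarMeasure :=
  Measure.IsAddHaarMeasure.comap (volume : Measure ℚ_[p]) (f := (ballSubgroup p N).subtype)
    (mH := ContinuousAdd.measurableAdd)
    (isOpen_ballSubgroup p N).isOpenEmbedding_subtypeVal

/-! ### The Vladimirov operator on the ball -/

/-- `λ₀ = (p - 1) / (p ^ (α + 1) - 1) * p ^ (α (1 - N))`. -/
def lambdaZero (p : ℕ) (N : ℤ) (α : ℝ) : ℝ :=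
  ((p : ℝ) - 1) / ((p : ℝ) ^ (α + 1) - 1) * (p : ℝ) ^ (α * (1 - (N : ℝ)))

/-- The constant `(1 - p ^ α) / (1 - p ^ (-α - 1))`. -/
def vladimirovConst (p : ℕ) (α : ℝ) : ℝ :=
  (1 - (p : ℝ) ^ α) / (1 - (p : ℝ) ^ (-α - 1))

/-- The Vladimirov operator `D_N^α` on the ball `B_N`, on locally constant functions. -/
def vladimirov {p : ℕ} [Fact p.Prime] {N : ℤ} (α : ℝ) (u : Ball p N → ℝ) (x : Ball p N) : ℝ :=
  lambdaZero p N α * u x +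
    vladimirovConst p α *
      ∫ y : Ball p N, ‖(y : ℚ_[p])‖ ^ (-α - 1) * (u (x - y) - u x)

/-- The space `𝒟(B_N)` of real-valued test functions, that is, of locally constant functions on
`B_N`.  (The parameter `α` only serves to attach the inner product `(D_N^α u, v)` to this type.) -/
def TestFunction (p : ℕ) [Fact p.Prime] (N : ℤ) (_α : ℝ) : Type :=
  LocallyConstant (Ball p N) ℝ

instance instAddCommGroupTestFunction (p : ℕ) [Fact p.Prime] (N : ℤ) (α : ℝ) :
    AddCommGroup (TestFunction p N α) :=
  inferInstanceAs (AddCommGroup (LocallyConstant (Ball p N) ℝ))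

instance instModuleTestFunction (p : ℕ) [Fact p.Prime] (N : ℤ) (α : ℝ) :
    Module ℝ (TestFunction p N α) :=
  inferInstanceAs (Module ℝ (LocallyConstant (Ball p N) ℝ))

instance instFunLikeTestFunction (p : ℕ) [Fact p.Prime] (N : ℤ) (α : ℝ) :
    FunLike (TestFunction p N α) (Ball p N) ℝ :=
  inferInstanceAs (FunLike (LocallyConstant (Ball p N) ℝ) (Ball p N) ℝ)

section Energy

variable {p : ℕ} [Fact p.Prime] {N : ℤ} {α : ℝ}

theorem TestFunction.isLocallyConstant (u : TestFunction p N α) : IsLocallyConstant u :=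
  LocallyConstant.isLocallyConstant (X := Ball p N) (Y := ℝ) u

theorem TestFunction.continuous (u : TestFunction p N α) : Continuous u :=
  u.isLocallyConstant.continuous

@[simp] theorem TestFunction.add_apply (u v : TestFunction p N α) (x : Ball p N) :
    (u + v) x = u x + v x := rfl

@[simp] theorem TestFunction.smul_apply (c : ℝ) (u : TestFunction p N α) (x : Ball p N) :
    (c • u) x = c * u x := rfl

theorem continuous_kernel (u : TestFunction p N α) :
    Continuous fun q : Ball p N × Ball p N =>
      ‖(q.2 : ℚ_[p])‖ ^ (-α - 1) * (u (q.1 - q.2) - u q.1) := by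
  have hu := u.continuous
  rw [continuous_iff_continuousAt]
  rintro ⟨x, y⟩
  by_cases hy : y = 0
  · subst hy
    have h1 : ∀ᶠ q : Ball p N × Ball p N in 𝓝 (x, 0), u q.1 = u x :=
      (continuous_fst.tendsto (x, (0 : Ball p N))).eventually
        (u.isLocallyConstant.eventually_eq x)
    have h2 : ∀ᶠ q : Ball p N × Ball p N in 𝓝 (x, 0), u (q.1 - q.2) = u x := by
      have ht : Tendsto (fun q : Ball p N × Ball p N => q.1 - q.2) (𝓝 (x, 0)) (𝓝 x) := by
        have hc : Continuous fun q : Ball p N × Ball p N => q.1 - q.2 :=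
          continuous_fst.sub continuous_snd
        have := hc.tendsto (x, (0 : Ball p N))
        simpa only [sub_zero] using this
      exact ht.eventually (u.isLocallyConstant.eventually_eq x)
    refine (continuousAt_const (y := (0 : ℝ))).congr ?_
    filter_upwards [h1, h2] with q e1 e2
    simp [e1, e2]
  · have hy' : ‖(y : ℚ_[p])‖ ≠ 0 := by simpa using hy
    refine ContinuousAt.mul ?_ ?_
    · refine ContinuousAt.rpow_const ?_ (Or.inl hy')
      exact (continuous_norm.comp (continuous_subtype_val.comp continuous_snd)).continuousAt
    · fun_prop

theorem integrable_of_continuous {X : Type*} [TopologicalSpace X] [CompactSpace X]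
    [MeasurableSpace X] [OpensMeasurableSpace X] {μ : Measure X}
    [IsFiniteMeasureOnCompacts μ] {f : X → ℝ} (hf : Continuous f) : Integrable f μ :=
  hf.integrable_of_hasCompactSupport (HasCompactSupport.of_compactSpace f)

theorem continuous_vladimirov (u : TestFunction p N α) : Continuous (vladimirov α u) := by
  have h := continuous_kernel u
  have hu := u.continuous
  have : Continuous fun x : Ball p N =>
      ∫ y : Ball p N, ‖(y : ℚ_[p])‖ ^ (-α - 1) * (u (x - y) - u x) := by
    have := continuous_parametric_integral_of_continuous (μ := (volume : Measure (Ball p N)))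
      (f := fun x y : Ball p N => ‖(y : ℚ_[p])‖ ^ (-α - 1) * (u (x - y) - u x)) h
      (s := Set.univ) isCompact_univ
    simpa using this
  unfold vladimirov
  fun_prop

/-- The quadratic form `(D_N^α u, v)_{L₂(B_N)}` on test functions. -/
def energy (u v : TestFunction p N α) : ℝ := ∫ x : Ball p N, vladimirov α u x * v x

theorem continuous_kernel_mul (u v : TestFunction p N α) :
    Continuous fun q : Ball p N × Ball p N =>
      ‖(q.2 : ℚ_[p])‖ ^ (-α - 1) * (u (q.1 - q.2) - u q.1) * (v (q.1 - q.2) - v q.1) := by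
  have h := continuous_kernel u
  have hv := v.continuous
  fun_prop

/-- The symmetric expression of the quadratic form. -/
theorem energy_eq (u v : TestFunction p N α) :
    energy u v = lambdaZero p N α * (∫ x : Ball p N, u x * v x) +
      (-vladimirovConst p α / 2) * ∫ y : Ball p N, ∫ x : Ball p N,
        ‖(y : ℚ_[p])‖ ^ (-α - 1) * (u (x - y) - u x) * (v (x - y) - v x) := by
  have hu := u.continuous
  have hv := v.continuous
  have hk := continuous_kernel u
  have hI1 : Integrable (fun x : Ball p N => u x * v x) volume :=
    integrable_of_continuous (by fun_prop)
  have hf : Continuous fun q : Ball p N × Ball p N =>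
      ‖(q.2 : ℚ_[p])‖ ^ (-α - 1) * (u (q.1 - q.2) - u q.1) * v q.1 := by fun_prop
  have hf' : Continuous fun q : Ball p N × Ball p N =>
      ‖(q.2 : ℚ_[p])‖ ^ (-α - 1) * (u (q.1 - q.2) - u q.1) * v (q.1 - q.2) := by fun_prop
  have hD : Integrable (fun x : Ball p N => (∫ y : Ball p N,
      ‖(y : ℚ_[p])‖ ^ (-α - 1) * (u (x - y) - u x)) * v x) volume := by
    have : Integrable (fun q : Ball p N × Ball p N =>
      ‖(q.2 : ℚ_[p])‖ ^ (-α - 1) * (u (q.1 - q.2) - u q.1) * v q.1)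
      ((volume : Measure (Ball p N)).prod volume) := integrable_of_continuous hf
    simpa only [integral_mul_const] using this.integral_prod_left
  have h1 : energy u v = lambdaZero p N α * (∫ x : Ball p N, u x * v x) +
      vladimirovConst p α * ∫ x : Ball p N, ∫ y : Ball p N,
        ‖(y : ℚ_[p])‖ ^ (-α - 1) * (u (x - y) - u x) * v x := by
    simp only [energy, vladimirov, integral_mul_const]
    rw [← integral_const_mul, ← integral_const_mul, ← integral_add (hI1.const_mul _)
      (hD.const_mul _)]
    congr 1
    ext x
    ring
  have h2 : (∫ x : Ball p N, ∫ y : Ball p N,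
        ‖(y : ℚ_[p])‖ ^ (-α - 1) * (u (x - y) - u x) * v x) =
      ∫ y : Ball p N, ∫ x : Ball p N,
        ‖(y : ℚ_[p])‖ ^ (-α - 1) * (u (x - y) - u x) * v x :=
    integral_integral_swap (integrable_of_continuous hf)
  have h3 : (∫ y : Ball p N, ∫ x : Ball p N,
        ‖(y : ℚ_[p])‖ ^ (-α - 1) * (u (x - y) - u x) * v x) =
      ∫ y : Ball p N, ∫ x : Ball p N,
        -(‖(y : ℚ_[p])‖ ^ (-α - 1) * (u (x - y) - u x) * v (x - y)) := by
    rw [← integral_neg_eq_self]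
    congr 1
    ext y
    rw [← integral_sub_right_eq_self _ y]
    congr 1
    ext x
    simp
    ring
  have i1 : ∀ y : Ball p N, Integrable (fun x : Ball p N =>
      ‖(y : ℚ_[p])‖ ^ (-α - 1) * (u (x - y) - u x) * v x) volume := fun y =>
    integrable_of_continuous (hf.comp (Continuous.prodMk_left y))
  have i2 : ∀ y : Ball p N, Integrable (fun x : Ball p N =>
      ‖(y : ℚ_[p])‖ ^ (-α - 1) * (u (x - y) - u x) * v (x - y)) volume := fun y =>
    integrable_of_continuous (hf'.comp (Continuous.prodMk_left y))
  have j1 : Integrable (fun y : Ball p N => ∫ x : Ball p N,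
      ‖(y : ℚ_[p])‖ ^ (-α - 1) * (u (x - y) - u x) * v x) volume :=
    (integrable_of_continuous (μ := (volume : Measure (Ball p N)).prod volume)
      hf).integral_prod_right
  have j2 : Integrable (fun y : Ball p N => ∫ x : Ball p N,
      ‖(y : ℚ_[p])‖ ^ (-α - 1) * (u (x - y) - u x) * v (x - y)) volume :=
    (integrable_of_continuous (μ := (volume : Measure (Ball p N)).prod volume)
      hf').integral_prod_right
  have h4 : (∫ y : Ball p N, ∫ x : Ball p N,
        ‖(y : ℚ_[p])‖ ^ (-α - 1) * (u (x - y) - u x) * (v (x - y) - v x)) =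
      (∫ y : Ball p N, ∫ x : Ball p N,
        ‖(y : ℚ_[p])‖ ^ (-α - 1) * (u (x - y) - u x) * v (x - y)) -
      ∫ y : Ball p N, ∫ x : Ball p N,
        ‖(y : ℚ_[p])‖ ^ (-α - 1) * (u (x - y) - u x) * v x := by
    rw [← integral_sub j2 j1]
    congr 1
    ext y
    rw [← integral_sub (i2 y) (i1 y)]
    congr 1
    ext x
    ring
  simp only [integral_neg] at h3
  rw [h1, h2, h4]
  linear_combination (vladimirovConst p α / 2) * h3

theorem lambdaZero_pos (p : ℕ) [hp : Fact p.Prime] (N : ℤ) (α : ℝ) [hα : Fact (0 < α)] :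
    0 < lambdaZero p N α := by
  have h1 : (1 : ℝ) < p := by exact_mod_cast hp.out.one_lt
  have h2 : (1 : ℝ) < (p : ℝ) ^ (α + 1) :=
    Real.one_lt_rpow h1 (by have := hα.out; linarith)
  unfold lambdaZero
  have h3 : (0 : ℝ) < (p : ℝ) ^ (α * (1 - (N : ℝ))) := Real.rpow_pos_of_pos (by linarith) _
  exact mul_pos (div_pos (by linarith) (by linarith)) h3

theorem vladimirovConst_nonpos (p : ℕ) [hp : Fact p.Prime] (α : ℝ) [hα : Fact (0 < α)] :
    vladimirovConst p α ≤ 0 := by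
  have h1 : (1 : ℝ) < p := by exact_mod_cast hp.out.one_lt
  have h2 : (1 : ℝ) < (p : ℝ) ^ α := Real.one_lt_rpow h1 hα.out
  have h3 : (p : ℝ) ^ (-α - 1) < 1 :=
    Real.rpow_lt_one_of_one_lt_of_neg h1 (by have := hα.out; linarith)
  exact div_nonpos_of_nonpos_of_nonneg (by linarith) (by linarith)

theorem lambdaZero_mul_le_energy [Fact (0 < α)] (u : TestFunction p N α) :
    lambdaZero p N α * (∫ x : Ball p N, u x * u x) ≤ energy u u := by
  rw [energy_eq]
  have h : 0 ≤ ∫ y : Ball p N, ∫ x : Ball p N,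
      ‖(y : ℚ_[p])‖ ^ (-α - 1) * (u (x - y) - u x) * (u (x - y) - u x) := by
    refine integral_nonneg fun y => integral_nonneg fun x => ?_
    simp only [Pi.zero_apply]
    rw [mul_assoc]
    exact mul_nonneg (Real.rpow_nonneg (norm_nonneg _) _) (mul_self_nonneg _)
  have h' := vladimirovConst_nonpos p α
  have : 0 ≤ -vladimirovConst p α / 2 := by linarith
  have := mul_nonneg this h
  linarith

theorem vladimirov_add (u v : TestFunction p N α) (x : Ball p N) :
    vladimirov α (u + v : TestFunction p N α) x = vladimirov α u x + vladimirov α v x := by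
  have i : ∀ w : TestFunction p N α, Integrable (fun y : Ball p N =>
      ‖(y : ℚ_[p])‖ ^ (-α - 1) * (w (x - y) - w x)) volume := fun w =>
    integrable_of_continuous ((continuous_kernel w).comp (Continuous.prodMk_right x))
  have e : (∫ y : Ball p N, ‖(y : ℚ_[p])‖ ^ (-α - 1) *
        ((u + v : TestFunction p N α) (x - y) - (u + v : TestFunction p N α) x)) =
      (∫ y : Ball p N, ‖(y : ℚ_[p])‖ ^ (-α - 1) * (u (x - y) - u x)) +
        ∫ y : Ball p N, ‖(y : ℚ_[p])‖ ^ (-α - 1) * (v (x - y) - v x) := by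
    rw [← integral_add (i u) (i v)]
    congr 1
    ext y
    simp only [TestFunction.add_apply]
    ring
  unfold vladimirov
  rw [e]
  simp only [TestFunction.add_apply]
  ring

theorem vladimirov_smul (c : ℝ) (u : TestFunction p N α) (x : Ball p N) :
    vladimirov α (c • u : TestFunction p N α) x = c * vladimirov α u x := by
  have e : (∫ y : Ball p N, ‖(y : ℚ_[p])‖ ^ (-α - 1) *
        ((c • u : TestFunction p N α) (x - y) - (c • u : TestFunction p N α) x)) =
      c * ∫ y : Ball p N, ‖(y : ℚ_[p])‖ ^ (-α - 1) * (u (x - y) - u x) := by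
    rw [← integral_const_mul]
    congr 1
    ext y
    simp only [TestFunction.smul_apply]
    ring
  unfold vladimirov
  rw [e]
  simp only [TestFunction.smul_apply]
  ring

/-- The inner product `(D_N^α u, v)_{L₂(B_N)}` on `𝒟(B_N)`.  In terms of an orthonormal basis of
eigenfunctions with eigenvalues `𝔞_k` it is `∑ 𝔞_k u_k v_k`. -/
@[reducible] def energyCore (p : ℕ) [Fact p.Prime] (N : ℤ) (α : ℝ) [Fact (0 < α)] :
    InnerProductSpace.Core ℝ (TestFunction p N α) where
  inner := energy
  conj_inner_symm u v := by
    simp only [conj_trivial]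
    rw [energy_eq, energy_eq]
    congr 2
    · congr 1; ext x; ring
    · congr 1; ext y; congr 1; ext x; ring
  re_inner_nonneg u := by
    have h := lambdaZero_mul_le_energy u
    have h0 : 0 ≤ ∫ x : Ball p N, u x * u x := integral_nonneg fun x => mul_self_nonneg _
    exact (mul_nonneg (lambdaZero_pos p N α).le h0).trans h
  add_left u v w := by
    have i : ∀ z : TestFunction p N α,
        Integrable (fun x : Ball p N => vladimirov α z x * w x) volume := fun z =>
      integrable_of_continuous ((continuous_vladimirov z).mul w.continuous)
    simp only [energy]
    rw [← integral_add (i u) (i v)]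
    congr 1
    ext x
    rw [vladimirov_add]
    ring
  smul_left u v c := by
    simp only [energy, conj_trivial]
    rw [← integral_const_mul]
    congr 1
    ext x
    rw [vladimirov_smul]
    ring
  definite u hu := by
    have h := lambdaZero_mul_le_energy u
    have hu' : energy u u = 0 := hu
    rw [hu'] at h
    have h0 : 0 ≤ ∫ x : Ball p N, u x * u x := integral_nonneg fun x => mul_self_nonneg _
    have hz : (∫ x : Ball p N, u x * u x) = 0 :=
      le_antisymm (nonpos_of_mul_nonpos_right h (lambdaZero_pos p N α)) h0
    have hc : Continuous fun x : Ball p N => u x * u x := u.continuous.mul u.continuous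
    have hae := (integral_eq_zero_iff_of_nonneg (fun x => mul_self_nonneg (u x))
      (integrable_of_continuous hc)).mp hz
    have hfun := (hc.ae_eq_iff_eq volume continuous_const).mp hae
    refine DFunLike.ext (F := LocallyConstant (Ball p N) ℝ) _ _ fun x => ?_
    exact mul_self_eq_zero.mp (congrFun hfun x)

end Energy

instance instNormedAddCommGroupTestFunction (p : ℕ) [Fact p.Prime] (N : ℤ) (α : ℝ)
    [Fact (0 < α)] : NormedAddCommGroup (TestFunction p N α) :=
  (energyCore p N α).toNormedAddCommGroup

instance instInnerProductSpaceTestFunction (p : ℕ) [Fact p.Prime] (N : ℤ) (α : ℝ)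
    [Fact (0 < α)] : InnerProductSpace ℝ (TestFunction p N α) :=
  InnerProductSpace.ofCore (energyCore p N α).toCore

/-! ### The Hilbert spaces `H₁` and `H₋₁` -/

/-- The Hilbert space `H₁`: the completion of `𝒟(B_N)` for the norm
`‖u‖² = (D_N^α u, u)_{L₂(B_N)} = ∑ 𝔞_k |u_k|²`. -/
abbrev H1 (p : ℕ) [Fact p.Prime] (N : ℤ) (α : ℝ) [Fact (0 < α)] : Type :=
  UniformSpace.Completion (TestFunction p N α)

section H1

variable {p : ℕ} [Fact p.Prime] {N : ℤ} {α : ℝ}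

/-- A test function, as an element of `L₂(B_N)`. -/
def TestFunction.toL2 (p : ℕ) [Fact p.Prime] (N : ℤ) (α : ℝ) :
    TestFunction p N α →ₗ[ℝ] Lp ℝ 2 (volume : Measure (Ball p N)) where
  toFun u := ContinuousMap.toLp (E := ℝ) 2 volume ℝ ⟨u, u.continuous⟩
  map_add' u v := by rw [← map_add]; rfl
  map_smul' c u := by rw [RingHom.id_apply, ← map_smul]; rfl

theorem TestFunction.coeFn_toL2 (u : TestFunction p N α) :
    (TestFunction.toL2 p N α u : Ball p N → ℝ) =ᵐ[volume] u :=
  ContinuousMap.coeFn_toLp (E := ℝ) (p := 2) (𝕜 := ℝ) volume ⟨u, u.continuous⟩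

/-- The embedding of `H₁` into `L₂(B_N)`: the continuous extension of the inclusion of
`𝒟(B_N)` into `L₂(B_N)`. -/
def H1.toL2 (p : ℕ) [Fact p.Prime] (N : ℤ) (α : ℝ) [Fact (0 < α)] :
    H1 p N α →L[ℝ] Lp ℝ 2 (volume : Measure (Ball p N)) :=
  (TestFunction.toL2 p N α).extendOfNorm
    (UniformSpace.Completion.toComplL (𝕜 := ℝ) (E := TestFunction p N α)).toLinearMap

theorem inner_eq_energy [Fact (0 < α)] (u v : TestFunction p N α) :
    inner ℝ u v = ∫ x : Ball p N, vladimirov α u x * v x := rfl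

theorem TestFunction.norm_toL2_le [Fact (0 < α)] (u : TestFunction p N α) :
    ‖TestFunction.toL2 p N α u‖ ≤ (Real.sqrt (lambdaZero p N α))⁻¹ * ‖u‖ := by
  have hl := lambdaZero_pos p N α
  have h1 : ‖TestFunction.toL2 p N α u‖ ^ 2 = ∫ x : Ball p N, u x * u x := by
    rw [← real_inner_self_eq_norm_sq, L2.inner_def]
    refine integral_congr_ae ?_
    filter_upwards [TestFunction.coeFn_toL2 u] with x hx
    simp [hx]
    ring
  have h2 : ‖u‖ ^ 2 = energy u u := by
    rw [← real_inner_self_eq_norm_sq]; rfl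
  have h3 := lambdaZero_mul_le_energy u
  rw [← h1, ← h2] at h3
  have hs := Real.sqrt_pos.mpr hl
  rw [inv_mul_eq_div, le_div_iff₀ hs]
  refine (sq_le_sq₀ (by positivity) (norm_nonneg _)).mp ?_
  rw [mul_pow, Real.sq_sqrt hl.le, mul_comm]
  exact h3

theorem H1.toL2_coe [Fact (0 < α)] (u : TestFunction p N α) :
    H1.toL2 p N α (u : H1 p N α) = TestFunction.toL2 p N α u :=
  LinearMap.extendOfNorm_eq (f := TestFunction.toL2 p N α)
    (e := (UniformSpace.Completion.toComplL (𝕜 := ℝ) (E := TestFunction p N α)).toLinearMap)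
    (UniformSpace.Completion.denseRange_coe)
    ⟨(Real.sqrt (lambdaZero p N α))⁻¹, fun x => by
      have := TestFunction.norm_toL2_le x
      simpa using this⟩ u

end H1

/-- The Hilbert space `H₋₁`, the dual of `H₁`. -/
def Hneg (p : ℕ) [Fact p.Prime] (N : ℤ) (α : ℝ) [Fact (0 < α)] : Type :=
  StrongDual ℝ (H1 p N α)

section Hneg

variable (p : ℕ) [Fact p.Prime] (N : ℤ) (α : ℝ) [Fact (0 < α)]

instance instNormedAddCommGroupHneg : NormedAddCommGroup (Hneg p N α) :=
  inferInstanceAs (NormedAddCommGroup (StrongDual ℝ (H1 p N α)))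

instance instNormedSpaceHneg : NormedSpace ℝ (Hneg p N α) :=
  inferInstanceAs (NormedSpace ℝ (StrongDual ℝ (H1 p N α)))

instance instFunLikeHneg : FunLike (Hneg p N α) (H1 p N α) ℝ :=
  inferInstanceAs (FunLike (StrongDual ℝ (H1 p N α)) (H1 p N α) ℝ)

/-- The isometric isomorphism `D_N^α : H₁ → H₋₁`, `(D_N^α w, v)_{H₋₁ × H₁} = (w, v)_{H₁}`.
By `vladimirovIso_coe_coe` it is the continuous extension of `D_N^α : 𝒟(B_N) → L₂(B_N)`. -/
def vladimirovIso : H1 p N α ≃ₗᵢ[ℝ] Hneg p N α :=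
  InnerProductSpace.toDual ℝ (H1 p N α)

theorem vladimirovIso_coe_coe (u v : TestFunction p N α) :
    vladimirovIso p N α (u : H1 p N α) (v : H1 p N α) =
      ∫ x : Ball p N, vladimirov α u x * v x :=
  UniformSpace.Completion.inner_coe u v

/-- The inner product of `H₋₁`, `(f, g)_{H₋₁} = ((D_N^α)⁻¹ f, (D_N^α)⁻¹ g)_{H₁}`. -/
instance instInnerProductSpaceHneg : InnerProductSpace ℝ (Hneg p N α) where
  inner f g := inner ℝ ((vladimirovIso p N α).symm f) ((vladimirovIso p N α).symm g)
  norm_sq_eq_re_inner f := by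
    simp
  conj_inner_symm f g := by
    simp [real_inner_comm]
  add_left f g h := by
    simp [inner_add_left]
  smul_left f g c := by
    simp [real_inner_smul_left]

end Hneg

/-! ### Subdifferentials and the functional `Ψ` -/

/-- The subdifferential of a function `F` with values in `[0, ∞]` on a real inner product space:
`∂F(u) = {g : F(v) - F(u) ≥ (g, v - u) for all v ∈ Dom(F)}`, `Dom(F) = {v : F(v) < ∞}`. -/
def subdifferential {E : Type*} [NormedAddCommGroup E] [InnerProductSpace ℝ E]
    (F : E → ℝ≥0∞) (u : E) : Set E :=
  {g | ∀ v, F v < ⊤ → ((F v : EReal) - (F u : EReal)) ≥ ((inner ℝ g (v - u) : ℝ) : EReal)}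

variable {p : ℕ} [Fact p.Prime] {N : ℤ} {α : ℝ} [Fact (0 < α)]

/-- The element `u ∈ H₋₁` is (given by) the function `g ∈ L₁(B_N)`. -/
def IsFunction (u : Hneg p N α) (g : Lp ℝ 1 (volume : Measure (Ball p N))) : Prop :=
  ∀ ψ : TestFunction p N α, u (ψ : H1 p N α) = ∫ x : Ball p N, g x * ψ x

/-- `Ψ(u) = ∫_{B_N} j(u) dx ∈ [0, ∞]` if `u ∈ H₋₁` is a function in `L₁(B_N)`, and `Ψ(u) = ∞`
otherwise.  An element of `H₋₁` is given by at most one `g ∈ L₁(B_N)`, so that the infimum is over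
at most one value; the integral is `∞` when `j(u)` is not in `L₁(B_N)`. -/
def Psi (j : ℝ → ℝ≥0∞) (u : Hneg p N α) : ℝ≥0∞ :=
  ⨅ (g : Lp ℝ 1 (volume : Measure (Ball p N))) (_ : IsFunction u g),
    ∫⁻ x : Ball p N, j (g x)

end

end PadicPorous

open PadicPorous

/-! Put `w = (D_N^α)⁻¹ f ∈ H₁`. The inner product of `f` and `v - u` in `H₋₁` is the pairing `⟨v -
u, w⟩`, so `f ∈ ∂Ψ(u)` says that `u` maximises `⟨v, w⟩ - Ψ(v)`. If pairings were integrals, this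
would be pointwise maximality of `s w(x) - j(s)` at `s = u(x)`, that is, `w(x) ∈ ∂j(u(x))`. But for
`u` merely in `L₁` and `w` unbounded, the product `u w` need not be integrable.

The gap is closed by a lemma of Brezis–Browder type (`IsFunction.integrable_mul_and_integral_eq`):
if `u w ≥ -h` with `h ≥ 0` integrable, then `u w` is integrable with integral `⟨u, w⟩`. It rests on
the Markov property: truncation to `[-k, k]` does not increase the energy, so the pairings with
truncations of `w` are controlled uniformly in `k` and converge to `⟨u, w⟩`; Fatou's lemma and
dominated convergence finish.

For `⇐`, the pointwise inequality supplies the lower bounds and is integrated. For `⇒`, only simple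
functions `v`, which all lie in `H₋₁`, are used as competitors: selecting nearly optimal ones
pointwise bounds the integral of the conjugate `j*(w)` by `⟨u, w⟩ - Ψ(u)`. Young's inequality `u w ≤
j(u) + j*(w)` then has a gap of integral at most zero, so equality holds a.e., which is the claim.
-/

namespace PadicPorous

noncomputable section

/-! ### Truncation to `[-k, k]`. -/

section Truncation

/-- Truncation of a real number to the interval `[-k, k]`. -/
def trunc (k : ℕ) (x : ℝ) : ℝ := max (-(k : ℝ)) (min x k)

theorem continuous_trunc (k : ℕ) : Continuous (trunc k) := by
  unfold trunc
  fun_prop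

@[simp] theorem trunc_zero (k : ℕ) : trunc k 0 = 0 := by
  simp [trunc]

theorem abs_trunc_le (k : ℕ) (x : ℝ) : |trunc k x| ≤ k := by
  have hk : (0 : ℝ) ≤ k := k.cast_nonneg
  rw [abs_le]
  exact ⟨le_max_left _ _, max_le (by linarith) (min_le_right _ _)⟩

theorem abs_trunc_sub_trunc_le (k : ℕ) (x y : ℝ) : |trunc k x - trunc k y| ≤ |x - y| := by
  have h1 : |max (-(k : ℝ)) (min x k) - max (-(k : ℝ)) (min y k)| ≤ |min x k - min y k| := by
    simpa using abs_max_sub_max_le_max (-(k : ℝ)) (min x k) (-(k : ℝ)) (min y k)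
  have h2 : |min x k - min y k| ≤ |x - y| := by
    simpa using abs_min_sub_min_le_max x (k : ℝ) y k
  exact h1.trans h2

theorem abs_trunc_le_abs (k : ℕ) (x : ℝ) : |trunc k x| ≤ |x| := by
  simpa using abs_trunc_sub_trunc_le k x 0

theorem trunc_eq_self {k : ℕ} {x : ℝ} (h : |x| ≤ k) : trunc k x = x := by
  rw [abs_le] at h
  rw [trunc, min_eq_left h.2, max_eq_right h.1]

theorem tendsto_trunc (x : ℝ) : Tendsto (fun k => trunc k x) atTop (𝓝 x) := by
  obtain ⟨n, hn⟩ := exists_nat_ge |x|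
  refine tendsto_const_nhds.congr' ?_
  filter_upwards [eventually_ge_atTop n] with k hk
  exact (trunc_eq_self (hn.trans (by exact_mod_cast hk))).symm

theorem exists_trunc_eq_mul (k : ℕ) (x : ℝ) : ∃ θ : ℝ, 0 ≤ θ ∧ θ ≤ 1 ∧ trunc k x = θ * x := by
  have hk : (0 : ℝ) ≤ k := k.cast_nonneg
  by_cases h : |x| ≤ k
  · exact ⟨1, zero_le_one, le_rfl, by rw [trunc_eq_self h, one_mul]⟩
  push Not at h
  have hx : 0 < |x| := hk.trans_lt h
  refine ⟨k / |x|, by positivity, (div_le_one hx).2 h.le, ?_⟩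
  rcases le_total 0 x with h0 | h0
  · rw [abs_of_nonneg h0] at h hx ⊢
    rw [trunc, min_eq_right h.le, max_eq_right (by linarith)]
    field_simp
  · rw [abs_of_nonpos h0] at h hx ⊢
    rw [trunc, min_eq_left (by linarith), max_eq_left (by linarith)]
    have : x ≠ 0 := by intro h; simp [h] at hx
    field_simp

/-- Truncation multiplies `x` by some `θ ∈ [0, 1]`, so the product lies between `0` and `a * x`,
both of which are at least `-h`. -/
theorem neg_le_mul_trunc {a x h : ℝ} (k : ℕ) (hh : 0 ≤ h) (hax : -h ≤ a * x) :
    -h ≤ a * trunc k x := by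
  obtain ⟨θ, h0, h1, e⟩ := exists_trunc_eq_mul k x
  rw [e]
  nlinarith

end Truncation

/-! ### Integrals of truncated products. -/

section Dominated

variable {X : Type*} [MeasurableSpace X] {μ : Measure X}

theorem tendsto_integral_mul_trunc {f W : X → ℝ} (hf : AEStronglyMeasurable f μ)
    (hW : AEStronglyMeasurable W μ) (hi : Integrable (fun x => f x * W x) μ) :
    Tendsto (fun k : ℕ => ∫ x, f x * trunc k (W x) ∂μ) atTop (𝓝 (∫ x, f x * W x ∂μ)) := by
  refine tendsto_integral_of_dominated_convergence (fun x => ‖f x * W x‖)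
    (fun k => hf.mul ((continuous_trunc k).comp_aestronglyMeasurable hW)) hi.norm
    (fun k => ae_of_all _ fun x => ?_) (ae_of_all _ fun x => (tendsto_trunc _).const_mul _)
  simp only [norm_mul, Real.norm_eq_abs]
  exact mul_le_mul_of_nonneg_left (abs_trunc_le_abs k _) (abs_nonneg _)

theorem integrable_mul_trunc {f W : X → ℝ} (hf : Integrable f μ)
    (hW : AEStronglyMeasurable W μ) (k : ℕ) : Integrable (fun x => f x * trunc k (W x)) μ :=
  hf.mul_bdd ((continuous_trunc k).comp_aestronglyMeasurable hW)
    (ae_of_all _ fun x => abs_trunc_le k (W x))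

theorem tendsto_integral_trunc_of_ae {f W : X → ℝ} {w : ℕ → X → ℝ} (hf : Integrable f μ)
    (hw : ∀ n, AEStronglyMeasurable (w n) μ)
    (hlim : ∀ᵐ x ∂μ, Tendsto (fun n => w n x) atTop (𝓝 (W x))) (k : ℕ) :
    Tendsto (fun n : ℕ => ∫ x, f x * trunc k (w n x) ∂μ) atTop
      (𝓝 (∫ x, f x * trunc k (W x) ∂μ)) := by
  refine tendsto_integral_of_dominated_convergence (fun x => ‖f x‖ * k)
    (fun n => (integrable_mul_trunc hf (hw n) k).aestronglyMeasurable)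
    (hf.norm.mul_const _) (fun n => ae_of_all _ fun x => ?_) ?_
  · simp only [norm_mul, Real.norm_eq_abs]
    exact mul_le_mul_of_nonneg_left (abs_trunc_le k _) (abs_nonneg _)
  · filter_upwards [hlim] with x hx
    exact (((continuous_trunc k).tendsto _).comp hx).const_mul _

/-- If the integrals of the truncated products `f * trunc k W` converge and `f * W` is bounded
below by an integrable function, then `f * W` is integrable. -/
theorem integrable_mul_of_tendsto_integral_trunc {f W h : X → ℝ} {c : ℝ} (hf : Integrable f μ)
    (hW : AEStronglyMeasurable W μ) (hh : Integrable h μ) (h0 : 0 ≤ᵐ[μ] h)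
    (hle : ∀ᵐ x ∂μ, -h x ≤ f x * W x)
    (hc : Tendsto (fun k : ℕ => ∫ x, f x * trunc k (W x) ∂μ) atTop (𝓝 c)) :
    Integrable (fun x => f x * W x) μ := by
  have hk := fun k => integrable_mul_trunc hf hW k
  -- Adding `h` makes the truncated products nonnegative, so Fatou's lemma bounds the integral of `f
  -- * W + h` by `c + ∫ h`.
  have hpos : ∀ k : ℕ, 0 ≤ᵐ[μ] fun x => f x * trunc k (W x) + h x := fun k => by
    filter_upwards [h0, hle] with x hx0 hx
    have := neg_le_mul_trunc k hx0 hx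
    simp only [Pi.zero_apply]
    linarith
  have hint : ∀ k : ℕ, ∫⁻ x, ENNReal.ofReal (f x * trunc k (W x) + h x) ∂μ =
      ENNReal.ofReal (∫ x, f x * trunc k (W x) ∂μ + ∫ x, h x ∂μ) := fun k => by
    rw [← integral_add (hk k) hh]
    exact (ofReal_integral_eq_lintegral_ofReal ((hk k).add hh) (hpos k)).symm
  have hlim : Tendsto (fun k : ℕ => ENNReal.ofReal (∫ x, f x * trunc k (W x) ∂μ + ∫ x, h x ∂μ))
      atTop (𝓝 (ENNReal.ofReal (c + ∫ x, h x ∂μ))) :=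
    (ENNReal.continuous_ofReal.tendsto _).comp (hc.add_const _)
  have hfatou := lintegral_liminf_le' (μ := μ) (u := atTop)
    (f := fun (k : ℕ) x => ENNReal.ofReal (f x * trunc k (W x) + h x))
    fun k => ((hk k).add hh).aemeasurable.ennreal_ofReal
  have hpt : ∀ x, liminf (fun k : ℕ => ENNReal.ofReal (f x * trunc k (W x) + h x)) atTop =
      ENNReal.ofReal (f x * W x + h x) := fun x =>
    ((ENNReal.continuous_ofReal.tendsto _).comp
      (((tendsto_trunc (W x)).const_mul (f x)).add_const (h x))).liminf_eq
  simp only [hpt, hint] at hfatou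
  rw [hlim.liminf_eq] at hfatou
  have hm : AEStronglyMeasurable (fun x => f x * W x + h x) μ :=
    (hf.aestronglyMeasurable.mul hW).add hh.aestronglyMeasurable
  have hsum : Integrable (fun x => f x * W x + h x) μ := by
    refine ⟨hm, ?_⟩
    rw [hasFiniteIntegral_iff_ofReal]
    · exact hfatou.trans_lt ENNReal.ofReal_lt_top
    · filter_upwards [hle] with x hx
      simp only [Pi.zero_apply]
      linarith
  exact (hsum.sub hh).congr (ae_of_all _ fun x => add_sub_cancel_right _ _)

end Dominated

/-! ### Subgradients as real inequalities. -/

theorem mem_subdifferential_iff {E : Type*} [NormedAddCommGroup E] [InnerProductSpace ℝ E]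
    {F : E → ℝ≥0∞} {v₀ : E} (h0 : F v₀ < ⊤) {u f : E} :
    f ∈ subdifferential F u ↔ F u < ⊤ ∧
      ∀ v, F v < ⊤ → inner ℝ f (v - u) ≤ (F v).toReal - (F u).toReal := by
  have key : F u < ⊤ → ∀ v, F v < ⊤ →
      (((F v : EReal) - (F u : EReal)) ≥ ((inner ℝ f (v - u) : ℝ) : EReal) ↔
        inner ℝ f (v - u) ≤ (F v).toReal - (F u).toReal) := fun hu v hv => by
    rw [← EReal.coe_ennreal_toReal hu.ne, ← EReal.coe_ennreal_toReal hv.ne, ← EReal.coe_sub,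
      ge_iff_le, EReal.coe_le_coe_iff]
  constructor
  · intro hf
    -- If `F u = ⊤`, the difference at `v₀` is `⊥` in `EReal` and cannot dominate a real number;
    -- this is why a point of finite value is required.
    have hu : F u < ⊤ := by
      by_contra h
      rw [not_lt, top_le_iff] at h
      have := hf v₀ h0
      rw [h, EReal.coe_ennreal_top, EReal.sub_top, ge_iff_le, le_bot_iff] at this
      exact EReal.coe_ne_bot _ this
    exact ⟨hu, fun v hv => (key hu v hv).1 (hf v hv)⟩
  · rintro ⟨hu, h⟩ v hv
    exact (key hu v hv).2 (h v hv)

/-- The equality case of Young's inequality: `c` is a subgradient at `r` exactly when `r` attains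
the supremum defining the conjugate `j*(c)`. -/
theorem mem_subdifferential_real_iff {j : ℝ → ℝ≥0∞} (hj : j 0 = 0) {r c : ℝ} :
    c ∈ subdifferential j r ↔ j r < ⊤ ∧
      ∀ s, j s < ⊤ → s * c - (j s).toReal ≤ r * c - (j r).toReal := by
  rw [mem_subdifferential_iff (v₀ := 0) (by rw [hj]; exact ENNReal.zero_lt_top)]
  refine and_congr_right fun _ => forall₂_congr fun s _ => ?_
  have : inner ℝ c (s - r) = s * c - r * c := by
    simp [sub_mul]
  rw [this]
  constructor <;> intro h <;> linarith

/-! ### The convex conjugate as a countable supremum over simple functions. -/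

section Conjugate

variable {X : Type*} [MeasurableSpace X] {μ : Measure X}

/-- Density is taken in the graph of `j` over its domain, not in the domain itself: the constraint
is closed in the pair `(r, j r)`, so no continuity of `j` is needed. -/
theorem exists_seq_dense_graph {j : ℝ → ℝ≥0∞} (hj : j 0 = 0) :
    ∃ s : ℕ → ℝ, (∀ n, j (s n) < ⊤) ∧ ∀ c b : ℝ, (∀ n, s n * c - (j (s n)).toReal ≤ b) →
      ∀ r, j r < ⊤ → r * c - (j r).toReal ≤ b := by
  set G : Set (ℝ × ℝ) := (fun r => (r, (j r).toReal)) '' {r | j r < ⊤}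
  have : Nonempty G := ⟨_, 0, by simp [hj], rfl⟩
  obtain ⟨d, hd⟩ := TopologicalSpace.exists_dense_seq G
  choose s hs hsd using fun n => (d n).2
  refine ⟨s, hs, fun c b h r hr => ?_⟩
  refine hd.induction_on (p := fun q : G => q.1.1 * c - q.1.2 ≤ b)
    ⟨(r, (j r).toReal), r, hr, rfl⟩ (isClosed_le (by fun_prop) continuous_const) fun n => ?_
  rw [← hsd n]
  exact h n

theorem integrable_simpleFunc_mul {W : X → ℝ} (hW : Integrable W μ) (v : SimpleFunc X ℝ) :
    Integrable (fun x => v x * W x) μ := by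
  obtain ⟨C, hC⟩ := v.exists_forall_norm_le
  exact hW.bdd_mul v.aestronglyMeasurable (ae_of_all _ hC)

/-- If the integrals of `v W - j(v)` over simple functions `v` are bounded by `C`, then the
pointwise supremum of `s W - j(s)` has an integrable bound with integral at most `C`. -/
theorem exists_integrable_conjugate_bound [IsFiniteMeasure μ] {j : ℝ → ℝ≥0∞} (hj : j 0 = 0) {W : X → ℝ}
    (hWm : Measurable W) (hW : Integrable W μ) {C : ℝ}
    (hC : ∀ v : SimpleFunc X ℝ, (∀ x, j (v x) < ⊤) →
      ∫ x, v x * W x ∂μ - ∫ x, (j (v x)).toReal ∂μ ≤ C) :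
    ∃ J : X → ℝ, Integrable J μ ∧ ∫ x, J x ∂μ ≤ C ∧
      ∀ᵐ x ∂μ, 0 ≤ J x ∧ ∀ s, j s < ⊤ → s * W x - (j s).toReal ≤ J x := by
  classical
  obtain ⟨s, hs, hsup⟩ := exists_seq_dense_graph hj
  set Φ : SimpleFunc X ℝ → X → ℝ := fun v x => v x * W x - (j (v x)).toReal
  have hjm : ∀ v : SimpleFunc X ℝ, Measurable fun x => (j (v x)).toReal := fun v =>
    (v.map fun r => (j r).toReal).measurable
  have hΦm : ∀ v, Measurable (Φ v) := fun v => (v.measurable.mul hWm).sub (hjm v)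
  have hji : ∀ v : SimpleFunc X ℝ, Integrable (fun x => (j (v x)).toReal) μ := fun v =>
    (v.map fun r => (j r).toReal).integrable_of_isFiniteMeasure
  have hΦi : ∀ v, Integrable (Φ v) μ := fun v => (integrable_simpleFunc_mul hW v).sub (hji v)
  have hset : ∀ (n : ℕ) (v : SimpleFunc X ℝ),
      MeasurableSet {x | Φ v x ≤ s n * W x - (j (s n)).toReal} := fun n v =>
    measurableSet_le (hΦm v) ((hWm.const_mul _).sub_const _)
  -- Greedy selection: `v (n + 1)` takes the value `s n` wherever this does not lower `Φ`. Starting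
  -- from `0`, where `Φ` vanishes, gives a nonnegative increasing sequence of admissible
  -- competitors.
  let v : ℕ → SimpleFunc X ℝ := fun n => Nat.rec (SimpleFunc.const X 0)
    (fun n v => SimpleFunc.piecewise _ (hset n v) (SimpleFunc.const X (s n)) v) n
  have hvs : ∀ n x, v (n + 1) x =
      if Φ (v n) x ≤ s n * W x - (j (s n)).toReal then s n else v n x := fun n x => by
    change (SimpleFunc.piecewise _ (hset n (v n)) (SimpleFunc.const X (s n)) (v n)) x = _
    rw [SimpleFunc.piecewise_apply]
    rfl
  have hvj : ∀ n x, j (v n x) < ⊤ := fun n x => by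
    induction n with
    | zero => change j 0 < ⊤; simp [hj]
    | succ n ih =>
      rw [hvs]
      split_ifs
      exacts [hs n, ih]
  have hΦs : ∀ n x, Φ (v (n + 1)) x = max (Φ (v n) x) (s n * W x - (j (s n)).toReal) :=
    fun n x => by
      have : Φ (v (n + 1)) x = v (n + 1) x * W x - (j (v (n + 1) x)).toReal := rfl
      rw [this, hvs]
      split_ifs with h
      · rw [max_eq_right h]
      · rw [max_eq_left (not_le.1 h).le]
  have hmono : ∀ x, Monotone fun n => Φ (v n) x := fun x =>
    monotone_nat_of_le_succ fun n => by rw [hΦs]; exact le_max_left _ _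
  have hzero : ∀ x, Φ (v 0) x = 0 := fun x => by
    change (0 : ℝ) * W x - (j 0).toReal = 0
    simp [hj]
  have hnn : ∀ n x, 0 ≤ Φ (v n) x := fun n x => by
    rw [← hzero x]; exact hmono x (Nat.zero_le n)
  have hint : ∀ n, ∫ x, Φ (v n) x ∂μ ≤ C := fun n => by
    rw [integral_sub (integrable_simpleFunc_mul hW _) (hji _)]
    exact hC _ (hvj n)
  have hC0 : 0 ≤ C := (integral_nonneg (hnn 0)).trans (hint 0)
  set S : X → ℝ≥0∞ := fun x => ⨆ n, ENNReal.ofReal (Φ (v n) x) with hS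
  have hSm : Measurable S := Measurable.iSup fun n => (hΦm _).ennreal_ofReal
  have hSint : ∫⁻ x, S x ∂μ ≤ ENNReal.ofReal C := by
    rw [hS, lintegral_iSup (fun n => (hΦm _).ennreal_ofReal)
      fun m n h x => ENNReal.ofReal_le_ofReal (hmono x h)]
    refine iSup_le fun n => ?_
    rw [← ofReal_integral_eq_lintegral_ofReal (hΦi _) (ae_of_all _ (hnn n))]
    exact ENNReal.ofReal_le_ofReal (hint n)
  have hSfin : ∫⁻ x, S x ∂μ ≠ ⊤ := (hSint.trans_lt ENNReal.ofReal_lt_top).ne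
  have hSae := ae_lt_top hSm hSfin
  refine ⟨fun x => (S x).toReal, integrable_toReal_of_lintegral_ne_top hSm.aemeasurable hSfin,
    ?_, ?_⟩
  · rw [integral_toReal hSm.aemeasurable hSae]
    exact ENNReal.toReal_le_of_le_ofReal hC0 hSint
  · filter_upwards [hSae] with x hx
    refine ⟨ENNReal.toReal_nonneg, hsup _ _ fun n => ?_⟩
    -- The candidate `s n` is first compared when `v (n + 1)` is formed, hence the shifted index.
    have h1 : Φ (v (n + 1)) x ≤ (S x).toReal :=
      (ENNReal.ofReal_le_iff_le_toReal hx.ne).1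
        (le_iSup (fun n => ENNReal.ofReal (Φ (v n) x)) (n + 1))
    rw [hΦs] at h1
    exact (le_max_right _ _).trans h1

end Conjugate

variable {p : ℕ} [Fact p.Prime] {N : ℤ} {α : ℝ}

/-! ### Test functions and the Markov property. -/

namespace TestFunction

/-- Composition of a test function with a function on the line. -/
def map (T : ℝ → ℝ) (u : TestFunction p N α) : TestFunction p N α :=
  LocallyConstant.map T u

@[simp] theorem map_apply (T : ℝ → ℝ) (u : TestFunction p N α) (x : Ball p N) :
    map T u x = T (u x) := rfl

/-- The indicator function of a clopen set. -/
def indicator {s : Set (Ball p N)} (hs : IsClopen s) : TestFunction p N α :=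
  LocallyConstant.charFn ℝ hs

theorem indicator_apply {s : Set (Ball p N)} (hs : IsClopen s) (x : Ball p N) :
    (indicator hs : TestFunction p N α) x = s.indicator 1 x := by
  change LocallyConstant.charFn ℝ hs x = _
  rw [LocallyConstant.coe_charFn]

/-- The Markov property: normal contractions do not increase the energy. -/
theorem energy_map_le [Fact (0 < α)] {T : ℝ → ℝ} (h0 : T 0 = 0)
    (hT : ∀ x y, |T x - T y| ≤ |x - y|) (u : TestFunction p N α) :
    energy (map T u) (map T u) ≤ energy u u := by
  have hsq : ∀ x y, (T x - T y) * (T x - T y) ≤ (x - y) * (x - y) := fun x y => by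
    simpa only [abs_mul_abs_self] using
      mul_self_le_mul_self (abs_nonneg _) (hT x y)
  have hc : ∀ w : TestFunction p N α, Integrable (fun y : Ball p N => ∫ x : Ball p N,
      ‖(y : ℚ_[p])‖ ^ (-α - 1) * (w (x - y) - w x) * (w (x - y) - w x)) := fun w =>
    (integrable_of_continuous (μ := (volume : Measure (Ball p N)).prod volume)
      (continuous_kernel_mul w w)).integral_prod_right
  have hi : ∀ (w : TestFunction p N α) (y : Ball p N), Integrable (fun x : Ball p N =>
      ‖(y : ℚ_[p])‖ ^ (-α - 1) * (w (x - y) - w x) * (w (x - y) - w x)) := fun w y =>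
    integrable_of_continuous ((continuous_kernel_mul w w).comp (Continuous.prodMk_left y))
  have h1 : ∫ x : Ball p N, map T u x * map T u x ≤ ∫ x : Ball p N, u x * u x := by
    refine integral_mono
      (integrable_of_continuous ((map T u).continuous.mul (map T u).continuous))
      (integrable_of_continuous (u.continuous.mul u.continuous)) fun x => ?_
    simpa [h0] using hsq (u x) 0
  have h2 : (∫ y : Ball p N, ∫ x : Ball p N, ‖(y : ℚ_[p])‖ ^ (-α - 1) *
        (map T u (x - y) - map T u x) * (map T u (x - y) - map T u x)) ≤
      ∫ y : Ball p N, ∫ x : Ball p N, ‖(y : ℚ_[p])‖ ^ (-α - 1) *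
        (u (x - y) - u x) * (u (x - y) - u x) := by
    refine integral_mono (hc _) (hc _) fun y => integral_mono (hi _ y) (hi _ y) fun x => ?_
    simp only [map_apply, mul_assoc]
    exact mul_le_mul_of_nonneg_left (hsq _ _) (Real.rpow_nonneg (norm_nonneg _) _)
  -- In the symmetric form both coefficients are nonnegative, so the energies compare termwise.
  rw [energy_eq, energy_eq]
  have hκ : 0 ≤ -vladimirovConst p α / 2 := by
    have := vladimirovConst_nonpos p α
    linarith
  exact add_le_add (mul_le_mul_of_nonneg_left h1 (lambdaZero_pos p N α).le)
    (mul_le_mul_of_nonneg_left h2 hκ)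

theorem norm_map_le [Fact (0 < α)] {T : ℝ → ℝ} (h0 : T 0 = 0)
    (hT : ∀ x y, |T x - T y| ≤ |x - y|) (u : TestFunction p N α) : ‖map T u‖ ≤ ‖u‖ := by
  refine (sq_le_sq₀ (norm_nonneg _) (norm_nonneg _)).mp ?_
  rw [← real_inner_self_eq_norm_sq, ← real_inner_self_eq_norm_sq]
  exact energy_map_le h0 hT u

end TestFunction

/-! ### Integration against test functions. -/

theorem exists_bound_of_continuous {X : Type*} [TopologicalSpace X] [CompactSpace X]
    {f : X → ℝ} (hf : Continuous f) : ∃ C, ∀ x, ‖f x‖ ≤ C := by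
  obtain ⟨C, hC⟩ := isCompact_univ.exists_bound_of_continuousOn hf.continuousOn
  exact ⟨C, fun x => hC x (Set.mem_univ x)⟩

theorem integrable_mul_continuous {f ψ : Ball p N → ℝ} (hf : Integrable f) (hψ : Continuous ψ) :
    Integrable fun x => f x * ψ x := by
  obtain ⟨C, hC⟩ := exists_bound_of_continuous hψ
  exact hf.mul_bdd hψ.aestronglyMeasurable (ae_of_all _ hC)

/-- An integrable function on the ball is determined by its integrals against test functions. -/
theorem ae_eq_zero_of_forall_integral_testFunction {f : Ball p N → ℝ} (hf : Integrable f)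
    (h : ∀ ψ : TestFunction p N α, ∫ x, f x * ψ x = 0) : f =ᵐ[volume] 0 := by
  -- Clopen sets are a basis of the ball, stable under intersection, and their indicators are test
  -- functions; a π-system argument then reaches all Borel sets.
  have hb : (inferInstance : MeasurableSpace (Ball p N)) =
      MeasurableSpace.generateFrom {s | IsClopen s} := by
    rw [BorelSpace.measurable_eq (α := Ball p N)]
    exact isTopologicalBasis_isClopen.borel_eq_generateFrom
  have hclopen : ∀ s : Set (Ball p N), IsClopen s → ∫ x in s, f x = 0 := fun s hs => by
    have := h (TestFunction.indicator hs)
    rw [← integral_indicator hs.isOpen.measurableSet, ← this]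
    congr 1
    ext x
    rw [TestFunction.indicator_apply]
    by_cases hx : x ∈ s <;> simp [hx]
  refine hf.ae_eq_zero_of_forall_setIntegral_eq_zero fun s hs _ => ?_
  refine MeasurableSpace.induction_on_inter
    (C := fun s _ => ∫ x in s, f x = 0) hb
    (fun s hs t ht _ => hs.inter ht) (by simp) (fun t ht => hclopen t ht) ?_ ?_ s hs
  · intro t ht h0
    have h1 := integral_add_compl ht hf
    have h2 := hclopen Set.univ isClopen_univ
    rw [setIntegral_univ] at h2
    rw [h0, h2, zero_add] at h1
    exact h1
  · intro t hd ht h0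
    rw [integral_iUnion ht hd hf.integrableOn]
    simp [h0]

/-! ### Functions in `H₋₁` and their pairing with `H₁`. -/

variable [Fact (0 < α)]

theorem IsFunction.unique {u : Hneg p N α} {g g' : Lp ℝ 1 (volume : Measure (Ball p N))}
    (h : IsFunction u g) (h' : IsFunction u g') : g = g' := by
  have hg := L1.integrable_coeFn g
  have hg' := L1.integrable_coeFn g'
  have := ae_eq_zero_of_forall_integral_testFunction (α := α) (hg.sub hg') fun ψ => by
    have e := (h ψ).symm.trans (h' ψ)
    simp only [Pi.sub_apply, sub_mul]
    rw [integral_sub (integrable_mul_continuous hg ψ.continuous)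
      (integrable_mul_continuous hg' ψ.continuous), e, sub_self]
  refine Lp.ext ?_
  filter_upwards [this] with x hx
  simpa [sub_eq_zero] using hx

theorem IsFunction.psi_eq {u : Hneg p N α} {g : Lp ℝ 1 (volume : Measure (Ball p N))}
    (h : IsFunction u g) (j : ℝ → ℝ≥0∞) : Psi j u = ∫⁻ x, j (g x) := by
  refine le_antisymm (iInf₂_le g h) (le_iInf₂ fun g' h' => ?_)
  rw [h.unique h']

theorem exists_isFunction_of_psi_lt_top {j : ℝ → ℝ≥0∞} {u : Hneg p N α} (h : Psi j u < ⊤) :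
    ∃ g, IsFunction u g := by
  simp only [Psi, iInf_lt_iff] at h
  obtain ⟨g, hg, -⟩ := h
  exact ⟨g, hg⟩

theorem IsFunction.sub {u v : Hneg p N α} {g k : Lp ℝ 1 (volume : Measure (Ball p N))}
    (hu : IsFunction u g) (hv : IsFunction v k) : IsFunction (u - v) (g - k) := fun ψ => by
  have e : (u - v) (ψ : H1 p N α) = u (ψ : H1 p N α) - v (ψ : H1 p N α) := rfl
  rw [e, hu ψ, hv ψ, ← integral_sub (integrable_mul_continuous (L1.integrable_coeFn g) ψ.continuous)
    (integrable_mul_continuous (L1.integrable_coeFn k) ψ.continuous)]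
  refine integral_congr_ae ?_
  filter_upwards [Lp.coeFn_sub g k] with x hx
  rw [hx, Pi.sub_apply, sub_mul]

theorem Hneg.apply_eq_inner (u : Hneg p N α) (w : H1 p N α) :
    u w = inner ℝ ((vladimirovIso p N α).symm u) w :=
  (InnerProductSpace.toDual_symm_apply (𝕜 := ℝ) (E := H1 p N α)).symm

/-- Replaces the `H₋₁` inner product in the subgradient inequality by a pairing with a fixed element
of `H₁`. -/
theorem inner_eq_apply (f v : Hneg p N α) :
    inner ℝ f v = v ((vladimirovIso p N α).symm f) := by
  rw [Hneg.apply_eq_inner]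
  exact real_inner_comm _ _

/-- Since `D_N^α η` is continuous, hence in `L₂`, both sides are continuous in `w`, and they agree
on the dense set of test functions. -/
theorem inner_coe_eq_integral (η : TestFunction p N α) (w : H1 p N α) :
    inner ℝ (η : H1 p N α) w = ∫ x, vladimirov α η x * H1.toL2 p N α w x := by
  have hη := continuous_vladimirov η
  set b : Lp ℝ 2 (volume : Measure (Ball p N)) :=
    ContinuousMap.toLp (E := ℝ) 2 volume ℝ ⟨vladimirov α η, hη⟩ with hb
  have hbc : (b : Ball p N → ℝ) =ᵐ[volume] vladimirov α η :=
    ContinuousMap.coeFn_toLp (E := ℝ) (p := 2) (𝕜 := ℝ) volume ⟨vladimirov α η, hη⟩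
  have hL : ∀ v : Lp ℝ 2 (volume : Measure (Ball p N)),
      ∫ x, vladimirov α η x * v x = inner ℝ b v := fun v => by
    rw [L2.inner_def]
    refine integral_congr_ae ?_
    filter_upwards [hbc] with x hx
    simp [hx, mul_comm]
  rw [hL]
  refine UniformSpace.Completion.induction_on w
    (isClosed_eq (by fun_prop) (by fun_prop)) fun ψ => ?_
  rw [← hL, UniformSpace.Completion.inner_coe, inner_eq_energy, H1.toL2_coe]
  refine integral_congr_ae ?_
  filter_upwards [TestFunction.coeFn_toL2 ψ] with x hx
  rw [hx]

/-- Convergence in `H₁` gives convergence in `L₂`, hence in measure, hence a.e. along a subsequence;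
the norm bound survives. -/
theorem exists_seq_testFunction (w : H1 p N α) : ∃ ψ : ℕ → TestFunction p N α,
    (∃ M, ∀ n, ‖ψ n‖ ≤ M) ∧
      ∀ᵐ x : Ball p N, Tendsto (fun n => ψ n x) atTop (𝓝 (H1.toL2 p N α w x)) := by
  obtain ⟨s, hs, hlim⟩ := mem_closure_iff_seq_limit.1
    ((UniformSpace.Completion.denseRange_coe (α := TestFunction p N α)) w)
  choose ψ hψ using hs
  have hL : Tendsto (fun n => H1.toL2 p N α (s n)) atTop (𝓝 (H1.toL2 p N α w)) :=
    ((H1.toL2 p N α).continuous.tendsto w).comp hlim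
  obtain ⟨ns, -, hns⟩ := (tendstoInMeasure_of_tendsto_Lp hL).exists_seq_tendsto_ae
  obtain ⟨M, hM⟩ := hlim.norm.bddAbove_range
  refine ⟨fun n => ψ (ns n), ⟨M, fun n => ?_⟩, ?_⟩
  · have := hM ⟨ns n, rfl⟩
    simpa only [← hψ, UniformSpace.Completion.norm_coe] using this
  · have hae : ∀ᵐ x : Ball p N, ∀ n, H1.toL2 p N α (s (ns n)) x = ψ (ns n) x := by
      rw [ae_all_iff]
      intro n
      rw [← hψ, H1.toL2_coe]
      exact TestFunction.coeFn_toL2 _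
    filter_upwards [hns, hae] with x hx hx'
    simpa only [hx'] using hx

/-- If `u ∈ H₋₁` is a function `g ∈ L₁`, its pairing with `w ∈ H₁` is the limit of the integrals of
`g` against the truncations of `w`. -/
theorem IsFunction.tendsto_integral_trunc {u : Hneg p N α}
    {g : Lp ℝ 1 (volume : Measure (Ball p N))} (hu : IsFunction u g) (w : H1 p N α) :
    Tendsto (fun k : ℕ => ∫ x, g x * trunc k (H1.toL2 p N α w x)) atTop (𝓝 (u w)) := by
  obtain ⟨ψ, ⟨M, hM⟩, hψ⟩ := exists_seq_testFunction w
  have hM0 : 0 ≤ M := (norm_nonneg _).trans (hM 0)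
  set z := (vladimirovIso p N α).symm u
  set W := H1.toL2 p N α w
  have hψm : ∀ n, AEStronglyMeasurable (fun x => ψ n x) (volume : Measure (Ball p N)) :=
    fun n => (ψ n).continuous.aestronglyMeasurable
  rw [Metric.tendsto_atTop]
  intro ε hε
  -- Replacing `u` by `D_N^α η` will cost `δ * M` on truncations and `δ * ‖w‖` on `w`, together
  -- below `ε / 2`. The other half of `ε` is for removing the truncation, and the `+ 1` keeps the
  -- denominator positive.
  set δ := ε / (2 * (M + ‖w‖ + 1)) with hδ
  have hden : 0 < M + ‖w‖ + 1 := by positivity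
  have hδ0 : 0 < δ := by positivity
  obtain ⟨η, hη⟩ := (UniformSpace.Completion.denseRange_coe
    (α := TestFunction p N α)).exists_dist_lt z hδ0
  rw [dist_eq_norm] at hη
  have hclose : ∀ v : H1 p N α, |u v - inner ℝ (η : H1 p N α) v| ≤ δ * ‖v‖ := fun v => by
    rw [Hneg.apply_eq_inner, ← inner_sub_left]
    exact (abs_real_inner_le_norm _ _).trans (mul_le_mul_of_nonneg_right hη.le (norm_nonneg _))
  have hDη : Integrable (vladimirov α η) := integrable_of_continuous (continuous_vladimirov η)
  have hDW : Integrable fun x => vladimirov α η x * W x := by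
    have := integrable_mul_continuous
      ((Lp.memLp W).integrable one_le_two) (continuous_vladimirov η)
    simpa only [mul_comm] using this
  -- The bound is proved for the truncated test functions `ψ n`, where the Markov property makes it
  -- independent of `k`, and passes to the limit in `n`.
  have h1 : ∀ k : ℕ, |(∫ x, g x * trunc k (W x)) - ∫ x, vladimirov α η x * trunc k (W x)|
      ≤ δ * M := fun k => by
    refine le_of_tendsto ((tendsto_integral_trunc_of_ae (L1.integrable_coeFn g) hψm hψ k).sub
      (tendsto_integral_trunc_of_ae hDη hψm hψ k)).abs (Eventually.of_forall fun n => ?_)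
    have hT := TestFunction.norm_map_le (trunc_zero k) (abs_trunc_sub_trunc_le k) (ψ n)
    have h2 := hclose (TestFunction.map (trunc k) (ψ n) : TestFunction p N α)
    rw [UniformSpace.Completion.inner_coe, inner_eq_energy, hu,
      UniformSpace.Completion.norm_coe] at h2
    exact h2.trans (mul_le_mul_of_nonneg_left (hT.trans (hM n)) hδ0.le)
  have h2 := hclose w
  rw [inner_coe_eq_integral] at h2
  have h3 := tendsto_integral_mul_trunc hDη.aestronglyMeasurable
    (Lp.aestronglyMeasurable W) hDW
  rw [Metric.tendsto_atTop] at h3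
  obtain ⟨n, hn⟩ := h3 (ε / 2) (half_pos hε)
  refine ⟨n, fun k hk => ?_⟩
  have h4 := hn k hk
  have h5 : δ * M + δ * ‖w‖ < ε / 2 := by
    have : δ * (M + ‖w‖ + 1) = ε / 2 := by rw [hδ]; field_simp
    nlinarith
  rw [Real.dist_eq] at h4 ⊢
  have h6 := h1 k
  rw [abs_lt] at *
  rw [abs_le] at *
  constructor <;> linarith [h2.1, h2.2, h6.1, h6.2, h4.1, h4.2]

/-- The lemma of Brezis and Browder for the pair `H₋₁ ∩ L₁`, `H₁`. -/
theorem IsFunction.integrable_mul_and_integral_eq {u : Hneg p N α}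
    {g : Lp ℝ 1 (volume : Measure (Ball p N))} (hu : IsFunction u g) (w : H1 p N α)
    {h : Ball p N → ℝ} (hh : Integrable h) (h0 : 0 ≤ᵐ[volume] h)
    (hle : ∀ᵐ x, -h x ≤ g x * H1.toL2 p N α w x) :
    Integrable (fun x => g x * H1.toL2 p N α w x) ∧
      ∫ x, g x * H1.toL2 p N α w x = u w := by
  have hlim := hu.tendsto_integral_trunc w
  have hW := Lp.aestronglyMeasurable (H1.toL2 p N α w)
  have hi := integrable_mul_of_tendsto_integral_trunc (L1.integrable_coeFn g) hW hh h0 hle hlim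
  exact ⟨hi, tendsto_nhds_unique
    (tendsto_integral_mul_trunc (Lp.aestronglyMeasurable g) hW hi) hlim⟩

/-! ### Simple functions as competitors in `H₋₁`. -/

/-- The element of `H₋₁` given by a function in `L₂`. -/
def Hneg.ofL2 (b : Lp ℝ 2 (volume : Measure (Ball p N))) : Hneg p N α :=
  (innerSL ℝ b).comp (H1.toL2 p N α)

theorem Hneg.ofL2_apply (b : Lp ℝ 2 (volume : Measure (Ball p N))) (w : H1 p N α) :
    Hneg.ofL2 b w = ∫ x, b x * H1.toL2 p N α w x := by
  have : Hneg.ofL2 b w = inner ℝ b (H1.toL2 p N α w) := rfl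
  rw [this, L2.inner_def]
  refine integral_congr_ae (ae_of_all _ fun x => ?_)
  simp [mul_comm]

theorem Hneg.isFunction_ofL2 {b : Lp ℝ 2 (volume : Measure (Ball p N))}
    {g : Lp ℝ 1 (volume : Measure (Ball p N))} (h : (g : Ball p N → ℝ) =ᵐ[volume] b) :
    IsFunction (Hneg.ofL2 b : Hneg p N α) g := fun ψ => by
  rw [Hneg.ofL2_apply, H1.toL2_coe]
  refine integral_congr_ae ?_
  filter_upwards [h, TestFunction.coeFn_toL2 ψ] with x h1 h2
  rw [h1, h2]

/-- A simple function gives an element of `H₋₁`. -/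
theorem exists_hneg_of_simpleFunc (v : SimpleFunc (Ball p N) ℝ) : ∃ V : Hneg p N α,
    (∀ w, V w = ∫ x, v x * H1.toL2 p N α w x) ∧ ∀ j : ℝ → ℝ≥0∞, Psi j V = ∫⁻ x, j (v x) := by
  have h2 : MemLp v 2 (volume : Measure (Ball p N)) := v.memLp_of_isFiniteMeasure 2 _
  have h1 : MemLp v 1 (volume : Measure (Ball p N)) := v.memLp_of_isFiniteMeasure 1 _
  refine ⟨Hneg.ofL2 (h2.toLp v), fun w => ?_, fun j => ?_⟩
  · rw [Hneg.ofL2_apply]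
    refine integral_congr_ae ?_
    filter_upwards [h2.coeFn_toLp] with x hx
    rw [hx]
  · have := Hneg.isFunction_ofL2 (α := α) (h1.coeFn_toLp.trans h2.coeFn_toLp.symm)
    rw [this.psi_eq]
    refine lintegral_congr_ae ?_
    filter_upwards [h1.coeFn_toLp] with x hx
    rw [hx]

theorem exists_psi_lt_top {j : ℝ → ℝ≥0∞} (hj : j 0 = 0) : ∃ V : Hneg p N α, Psi j V < ⊤ := by
  obtain ⟨V, -, hV⟩ := exists_hneg_of_simpleFunc (α := α) (SimpleFunc.const (Ball p N) (0 : ℝ))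
  exact ⟨V, by simp [hV, hj]⟩

theorem integrable_toReal_comp {j : ℝ → ℝ≥0∞} (hjm : Measurable j)
    {g : Lp ℝ 1 (volume : Measure (Ball p N))} (h : ∫⁻ x, j (g x) < ⊤) :
    Integrable (fun x => (j (g x)).toReal) ∧ (∀ᵐ x, j (g x) < ⊤) ∧
      ∫ x, (j (g x)).toReal = (∫⁻ x, j (g x)).toReal := by
  have hm : Measurable fun x => j (g x) := hjm.comp (Lp.stronglyMeasurable g).measurable
  have hae := ae_lt_top hm h.ne
  exact ⟨integrable_toReal_of_lintegral_ne_top hm.aemeasurable h.ne, hae,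
    integral_toReal hm.aemeasurable hae⟩

/-! ### The two implications. -/

theorem mem_subdifferential_psi {j : ℝ → ℝ≥0∞} (hjm : Measurable j) (hj : j 0 = 0)
    {u f : Hneg p N α} {g : Lp ℝ 1 (volume : Measure (Ball p N))} (hu : IsFunction u g)
    (h : ∀ᵐ x, H1.toL2 p N α ((vladimirovIso p N α).symm f) x ∈ subdifferential j (g x)) :
    f ∈ subdifferential (Psi j) u := by
  obtain ⟨V₀, hV₀⟩ := exists_psi_lt_top (p := p) (N := N) (α := α) hj
  rw [mem_subdifferential_iff hV₀]
  simp only [mem_subdifferential_real_iff hj] at h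
  set w := (vladimirovIso p N α).symm f
  -- Testing the pointwise inequality at `s = 0` gives `g * w ≥ j(g) ≥ 0`, so `h = 0` serves as
  -- lower bound; the same inequality then makes `j(g)` integrable.
  obtain ⟨hi, he⟩ := hu.integrable_mul_and_integral_eq w (integrable_zero _ _ _)
    (ae_of_all _ fun _ => le_rfl) (by
      filter_upwards [h] with x hx
      have := hx.2 0 (by simp [hj])
      simp only [hj, zero_mul, ENNReal.toReal_zero, sub_zero] at this
      have := ENNReal.toReal_nonneg (a := j (g x))
      simp only [Pi.zero_apply, neg_zero]
      linarith)
  have hfin : ∫⁻ x, j (g x) < ⊤ := by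
    refine (lintegral_mono_ae ?_).trans_lt hi.lintegral_lt_top
    filter_upwards [h] with x hx
    have := hx.2 0 (by simp [hj])
    simp only [hj, zero_mul, ENNReal.toReal_zero, sub_zero] at this
    rw [← ENNReal.ofReal_toReal hx.1.ne]
    exact ENNReal.ofReal_le_ofReal (by linarith)
  obtain ⟨hgi, -, hge⟩ := integrable_toReal_comp hjm hfin
  rw [hu.psi_eq]
  refine ⟨hfin, fun v hv => ?_⟩
  obtain ⟨k, hk⟩ := exists_isFunction_of_psi_lt_top hv
  rw [hk.psi_eq] at hv ⊢
  obtain ⟨hki, hkfin, hke⟩ := integrable_toReal_comp hjm hv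
  have hsub : ∀ᵐ x : Ball p N, (j (g x)).toReal - (j (k x)).toReal ≤
      (g - k : Lp ℝ 1 (volume : Measure (Ball p N))) x * H1.toL2 p N α w x := by
    filter_upwards [h, hkfin, Lp.coeFn_sub g k] with x hx hkx hs
    have := hx.2 _ hkx
    rw [hs, Pi.sub_apply, sub_mul]
    linarith
  -- Here `(g - k) * w ≥ j(g) - j(k) ≥ -j(k)`, and `j(k)` is integrable.
  obtain ⟨hi', he'⟩ := (hu.sub hk).integrable_mul_and_integral_eq w hki
    (ae_of_all _ fun x => ENNReal.toReal_nonneg) (by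
      filter_upwards [hsub] with x hx
      have := ENNReal.toReal_nonneg (a := j (g x))
      linarith)
  have hle := integral_mono_ae (hgi.sub hki) hi' hsub
  have hs := integral_sub hgi hki
  simp only [Pi.sub_apply] at hle
  have e1 : (u - v) w = u w - v w := rfl
  have e2 : (v - u) w = v w - u w := rfl
  rw [inner_eq_apply, e2, ← hge, ← hke]
  linarith

theorem exists_isFunction_of_mem_subdifferential_psi {j : ℝ → ℝ≥0∞} (hjm : Measurable j)
    (hj : j 0 = 0) {u f : Hneg p N α} (h : f ∈ subdifferential (Psi j) u) :
    ∃ g : Lp ℝ 1 (volume : Measure (Ball p N)), IsFunction u g ∧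
      ∀ᵐ x, H1.toL2 p N α ((vladimirovIso p N α).symm f) x ∈ subdifferential j (g x) := by
  obtain ⟨V₀, hV₀⟩ := exists_psi_lt_top (p := p) (N := N) (α := α) hj
  rw [mem_subdifferential_iff hV₀] at h
  obtain ⟨hfin, h⟩ := h
  obtain ⟨g, hu⟩ := exists_isFunction_of_psi_lt_top hfin
  rw [hu.psi_eq] at hfin h
  refine ⟨g, hu, ?_⟩
  obtain ⟨hgi, hgfin, hge⟩ := integrable_toReal_comp hjm hfin
  simp only [inner_eq_apply] at h
  set w := (vladimirovIso p N α).symm f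
  set W := H1.toL2 p N α w
  have hW : Integrable W := (Lp.memLp W).integrable one_le_two
  -- The constant is the subgradient inequality at a simple `v`, rearranged as `⟨v, w⟩ - Ψ(v) ≤ ⟨u,
  -- w⟩ - Ψ(u)`.
  obtain ⟨J, hJi, hJ, hJae⟩ := exists_integrable_conjugate_bound hj
    (Lp.stronglyMeasurable W).measurable hW (C := u w - ∫ x, (j (g x)).toReal) fun v hv => by
      obtain ⟨V, hVw, hVj⟩ := exists_hneg_of_simpleFunc (α := α) v
      have hsum : Integrable (fun x => (j (v x)).toReal) (volume : Measure (Ball p N)) :=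
        (v.map fun r => (j r).toReal).integrable_of_isFiniteMeasure
      have hlin : ∫⁻ x, j (v x) = ENNReal.ofReal (∫ x, (j (v x)).toReal) := by
        rw [ofReal_integral_eq_lintegral_ofReal hsum (ae_of_all _ fun x => ENNReal.toReal_nonneg)]
        exact lintegral_congr fun x => (ENNReal.ofReal_toReal (hv x).ne).symm
      have := h V (by rw [hVj, hlin]; exact ENNReal.ofReal_lt_top)
      have e : (V - u) w = V w - u w := rfl
      rw [e, hVw, hVj, hlin, ENNReal.toReal_ofReal
        (integral_nonneg fun x => ENNReal.toReal_nonneg), ← hge] at this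
      linarith
  have hyoung : ∀ᵐ x, g x * W x - (j (g x)).toReal ≤ J x := by
    filter_upwards [hJae, hgfin] with x hx hgx using hx.2 _ hgx
  have hneg : ∀ᵐ x : Ball p N, H1.toL2 p N α (-w) x = -W x := by
    rw [map_neg]
    exact Lp.coeFn_neg W
  -- Young's inequality bounds `g * W` from above by `J + j(g)`, so the lemma is applied to `-w`.
  obtain ⟨hi, he⟩ := hu.integrable_mul_and_integral_eq (-w) (hJi.add hgi) (by
      filter_upwards [hJae] with x hx
      exact add_nonneg hx.1 ENNReal.toReal_nonneg) (by
      filter_upwards [hyoung, hneg] with x hx hn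
      rw [hn, Pi.add_apply]
      linarith)
  have hgW : (fun x => g x * H1.toL2 p N α (-w) x) =ᵐ[volume] fun x => -(g x * W x) := by
    filter_upwards [hneg] with x hn
    rw [hn, mul_neg]
  have hi' : Integrable fun x => g x * W x := by
    simpa using (hi.congr hgW).neg
  have e : u (-w) = -u w := map_neg (show StrongDual ℝ (H1 p N α) from u) w
  rw [integral_congr_ae hgW, integral_neg, e, neg_inj] at he
  have hb : Integrable fun x => g x * W x - (j (g x)).toReal := hi'.sub hgi
  have hd : Integrable fun x => J x - (g x * W x - (j (g x)).toReal) := hJi.sub hb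
  have hd0 : 0 ≤ᵐ[volume] fun x => J x - (g x * W x - (j (g x)).toReal) := by
    filter_upwards [hyoung] with x hx using sub_nonneg.2 hx
  -- The nonnegative gap in Young's inequality has integral at most `0`, since `∫ J ≤ ⟨u, w⟩ - ∫
  -- j(g)` and `∫ g * W = ⟨u, w⟩`.
  have hz : ∫ x, J x - (g x * W x - (j (g x)).toReal) = 0 := by
    refine le_antisymm ?_ (integral_nonneg_of_ae hd0)
    rw [integral_sub hJi hb, integral_sub hi' hgi, he]
    linarith
  filter_upwards [(integral_eq_zero_iff_of_nonneg_ae hd0 hd).1 hz, hJae, hgfin] with x hx hJx hgx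
  rw [mem_subdifferential_real_iff hj]
  refine ⟨hgx, fun s hs => ?_⟩
  have := hJx.2 s hs
  simp only [Pi.zero_apply] at hx
  linarith

end

end PadicPorous

theorem mainTheorem5 (p : ℕ) [Fact p.Prime] (N : ℤ) (α : ℝ) [Fact (0 < α)]
    (j : ℝ → ℝ≥0∞)
    (hj_convex : ConvexOn ℝ≥0 Set.univ j)
    (hj_lsc : LowerSemicontinuous j)
    (hj_zero : j 0 = 0)
    (hj_superlinear :
      Tendsto (fun r : ℝ => j r / ENNReal.ofReal |r|) (cocompact ℝ) (𝓝 ⊤))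
    (φ : ℝ → Set ℝ)
    (hφ : ∀ r : ℝ, φ r = subdifferential j r)
    (u f : Hneg p N α) :
    f ∈ subdifferential (Psi j) u ↔
      ∃ g : Lp ℝ 1 (volume : Measure (Ball p N)), IsFunction u g ∧
        ∀ᵐ x : Ball p N, H1.toL2 p N α ((vladimirovIso p N α).symm f) x ∈ φ (g x) := by
  have hjm : Measurable j := hj_lsc.measurable
  simp only [hφ]
  constructor
  · exact exists_isFunction_of_mem_subdifferential_psi hjm hj_zero
  · rintro ⟨g, hu, h⟩
    exact mem_subdifferential_psi hjm hj_zero hu h
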